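/- All graphs are finite and simple. For graphs $G,H$ let $N_{\mathrm{ind}}(G,H)$ be the number of induced subgraphs of $H$ isomorphic to $G$, and let $\mathrm{eind}(G,m)$ be the maximum of $N_{\mathrm{ind}}(G,H)$ over all graphs $H$ with exactly $m$ edges. The fractional independence number $\alpha^*(G)$ is the maximum of $\sum_{v}\alpha(v)$ over all $\alpha\colon V(G)\to[0,1]$ with $\alpha(u)+\alpha(v)\le 1$ for every edge $uv$. For $G$ without isolated vertices, the edge inducibility is $$\mathrm{eind}(G)=\limsup_{m\to\infty}\frac{|\mathrm{Aut}(G)|\,\mathrm{eind}(G,m)}{(2m)^{\alpha^*(G)}}.$$ A fractional perfect matching of $G$ is a function $w\colon E(G)\to[0,1]$ such that $\sum_{e\ni v}w(e)=1$ for every vertex $v$. A local digraph is a finite multigraph without self-loops together with a sign $\mathrm{sgn}(v,e)\in\{+,-\}$ for each vertex $v$ and each edge $e$ incident to $v$. Two local digraphs are isomorphic if there is a multigraph isomorphism $(f_V,f_E)$ between them such that, for all edges $e,e'$ with a common endpoint $v$, $\mathrm{sgn}(v,e)=\mathrm{sgn}(v,e')$ if and only if $\mathrm{sgn}(f_V(v),f_E(e))=\mathrm{sgn}(f_V(v),f_E(e'))$.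 A locally directed closed walk is a closed walk $v_1\xrightarrow{e_1}v_2\xrightarrow{e_2}\cdots\xrightarrow{e_{t-1}}v_t\xrightarrow{e_t=e_0}v_{t+1}=v_1$ with $t\ge1$ and $\mathrm{sgn}(v_i,e_i)\ne\mathrm{sgn}(v_i,e_{i-1})$ for all $1\le i\le t$; a local digraph is acyclic if it has no locally directed closed walk. For local digraphs $D,H$ let $N_{\mathrm{ind}}(D,H)$ be the number of vertex subsets of $H$ whose induced local digraph is isomorphic to $D$, and, with $v(\cdot)$ denoting the number of vertices, define $$\mathrm{ind}(D)=\limsup_{n\to\infty}\max_{v(H)=n}\frac{N_{\mathrm{ind}}(D,H)}{\binom{n}{v(D)}},$$ where $H$ ranges over all local digraphs with $n$ vertices; $\mathrm{aind}(D)$ is defined by the same expression with $H$ ranging over the acyclic local digraphs with $n$ vertices. For a graph $G$ with a perfect matching $M$, label the endpoints of each edge of $M$ with a plus and a minus sign in an arbitrary way. The local digraph $\mathrm{ldg}(G,M)$ has the edges of $M$ as its vertices and has one edge $\tilde e$ for each $e\in E(G)\setminus M$: if $e_1,e_2\in M$ are the edges of $M$ containing the endpoints of $e$, then $\tilde e$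 joins $e_1$ and $e_2$, and $\mathrm{sgn}(e_i,\tilde e)$ is the sign of the common vertex of $e_i$ and $e$, for $i=1,2$. (Up to isomorphism it does not depend on the labelling.) **Theorem.** Let $G$ be a graph with a perfect matching $M$ such that (the indicator function of) $M$ is the unique fractional perfect matching of $G$. Then $$\mathrm{aind}(\mathrm{ldg}(G,M))\le\frac{2^{|M|}\,|M|!}{|\mathrm{Aut}(G)|}\,\mathrm{eind}(G)\le\mathrm{ind}(\mathrm{ldg}(G,M)).$$ -/

import Mathlib

open Filter
open scoped ENNReal

namespace EdgeInducibility

/-! ### Fractional notions for finite simple graphs -/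

section Graphs

variable {V : Type*}

open Classical in
/-- A fractional perfect matching of `G`: a function `w : E(G) → [0,1]` such that for every vertex
the weights of the edges incident to it sum to exactly `1`. -/
def IsFractionalPerfectMatching [Fintype V] (G : SimpleGraph V) (w : G.edgeSet → ℝ) : Prop :=
  (∀ e, 0 ≤ w e ∧ w e ≤ 1) ∧
    ∀ v : V, ∑ e ∈ Finset.univ.filter (fun e : G.edgeSet => v ∈ (e : Sym2 V)), w e = 1

open Classical in
/-- A matching, viewed as a function on the edges: `1` on the edges of `M`, `0` elsewhere. -/
noncomputable def matchingWeight {G : SimpleGraph V} (M : G.Subgraph) (e : G.edgeSet) : ℝ :=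
  if (e : Sym2 V) ∈ M.edgeSet then 1 else 0

/-- The fractional independence number `α*(G)`: the maximum (the feasible region is a nonempty
polytope) of `∑ v, a v` over all `a : V → [0,1]` with `a u + a v ≤ 1` for every edge `uv`. -/
noncomputable def fracIndepNum [Fintype V] (G : SimpleGraph V) : ℝ :=
  sSup {s : ℝ | ∃ a : V → ℝ, (∀ v, 0 ≤ a v ∧ a v ≤ 1) ∧
    (∀ u v, G.Adj u v → a u + a v ≤ 1) ∧ s = ∑ v, a v}

/-- The number of induced copies of `G` in `H`: the number of induced subgraphs of `H`
(i.e. of vertex subsets) which are isomorphic to `G`. -/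
noncomputable def graphIndCount {W : Type*} (G : SimpleGraph V) (H : SimpleGraph W) : ℕ :=
  {S : Set W | Nonempty (G ≃g H.induce S)}.ncard

/-- `eind(G,m)`: the supremum of the number of induced copies of `G` over all finite graphs with
exactly `m` edges (and any number of vertices). -/
noncomputable def eindNum (G : SimpleGraph V) (m : ℕ) : ℝ≥0∞ :=
  ⨆ (n : ℕ) (H : SimpleGraph (Fin n)) (_ : H.edgeSet.ncard = m), (graphIndCount G H : ℝ≥0∞)

/-- The edge inducibility
`eind(G) = limsup_{m → ∞} |Aut G| * eind(G,m) / (2m)^{α*(G)}`, as an element of `[0,∞]`. -/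
noncomputable def eind [Fintype V] (G : SimpleGraph V) : ℝ≥0∞ :=
  limsup (fun m : ℕ =>
    (Nat.card (G ≃g G) : ℝ≥0∞) * eindNum G m / (2 * (m : ℝ≥0∞)) ^ fracIndepNum G) atTop

end Graphs

/-! ### Locally directed graphs -/

/-- A local digraph with vertex type `V` and edge type `E`: a multigraph without self-loops
together with a sign for each incident pair of a vertex and an edge; `true` is the positive sign
and `false` the negative sign. The value `sgn v e` carries meaning only if `v ∈ ends e`. -/
structure LocalDigraph (V E : Type*) where
  /-- the unordered pair of endpoints of an edge -/
  ends : E → Sym2 V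
  /-- there are no self-loops -/
  not_isDiag : ∀ e, ¬ (ends e).IsDiag
  /-- the sign of the edge `e` at the vertex `v` -/
  sgn : V → E → Bool

namespace LocalDigraph

variable {V E W F : Type*}

/-- An isomorphism of local digraphs: an isomorphism of multigraphs such that two edges have equal
signs at a common endpoint if and only if their images have. (The signs themselves need not
be preserved: they may be switched at any vertex.) -/
structure Iso (G : LocalDigraph V E) (H : LocalDigraph W F) where
  /-- the bijection between the vertices -/
  onV : V ≃ W
  /-- the bijection between the edges -/
  onE : E ≃ F
  ends_onE : ∀ e, H.ends (onE e) = (G.ends e).map onV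
  sgn_iff : ∀ v e e', v ∈ G.ends e → v ∈ G.ends e' →
    (G.sgn v e = G.sgn v e' ↔ H.sgn (onV v) (onE e) = H.sgn (onV v) (onE e'))

/-- The local digraph induced by `H` on the vertex set `S`: all edges with both endpoints in `S`,
with their signs. -/
def induce (H : LocalDigraph V E) (S : Set V) :
    LocalDigraph S {e : E // ∀ v ∈ H.ends e, v ∈ S} where
  ends e := (H.ends e.1).attachWith e.2
  not_isDiag e h := H.not_isDiag e.1 <| by
    have h2 : ((H.ends e.1).attachWith e.2).map Subtype.val = H.ends e.1 :=
      Sym2.attachWith_map_subtypeVal e.2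
    rw [← h2]
    exact h.map
  sgn v e := H.sgn v.1 e.1

/-- The number of induced local digraphs of `H` that are isomorphic to `G`. -/
noncomputable def indCount (G : LocalDigraph V E) (H : LocalDigraph W F) : ℕ :=
  {S : Set W | Nonempty (Iso G (H.induce S))}.ncard

/-- A locally directed closed walk of length `t ≥ 1`:
`v 0 --e 0--> v 1 --e 1--> ⋯ --e (t-1)--> v t = v 0`, with `e t = e 0`, such that at each
vertex of the walk the edge used to arrive and the edge used to leave have different signs. -/
def HasLocallyDirectedClosedWalk (H : LocalDigraph V E) : Prop :=
  ∃ (t : ℕ) (v : ℕ → V) (e : ℕ → E), 0 < t ∧ v t = v 0 ∧ e t = e 0 ∧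
    (∀ i < t, H.ends (e i) = s(v i, v (i + 1))) ∧
    ∀ i < t, H.sgn (v (i + 1)) (e (i + 1)) ≠ H.sgn (v (i + 1)) (e i)

/-- A locally directed acyclic graph: no locally directed closed walk. -/
def IsAcyclic (H : LocalDigraph V E) : Prop :=
  ¬ H.HasLocallyDirectedClosedWalk

/-- The vertex inducibility `ind(G) = limsup_{n → ∞} max_H N_ind(G,H) / C(n, v(G))`, where `H`
ranges over all finite local digraphs with `n` vertices. -/
noncomputable def ind (G : LocalDigraph V E) : ℝ≥0∞ :=
  limsup (fun n : ℕ => ⨆ (m : ℕ) (H : LocalDigraph (Fin n) (Fin m)),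
    (indCount G H : ℝ≥0∞) / (n.choose (Nat.card V) : ℝ≥0∞)) atTop

/-- The acyclic vertex inducibility: as `ind`, with `H` ranging over the acyclic
finite local digraphs with `n` vertices. -/
noncomputable def aind (G : LocalDigraph V E) : ℝ≥0∞ :=
  limsup (fun n : ℕ => ⨆ (m : ℕ) (H : LocalDigraph (Fin n) (Fin m)) (_ : H.IsAcyclic),
    (indCount G H : ℝ≥0∞) / (n.choose (Nat.card V) : ℝ≥0∞)) atTop

end LocalDigraph

/-! ### The local digraph of a graph with a perfect matching -/

section Ldg

variable {V : Type*} {G : SimpleGraph V}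

/-- A choice of signs for the endpoints of the edges of `M`: for every edge of `M`, one endpoint
gets the positive and the other the negative sign. -/
def IsSignLabelling (M : G.Subgraph) (σ : V → Bool) : Prop :=
  ∀ u v, M.Adj u v → σ u ≠ σ v

/-- The edge of the perfect matching `M` that contains the vertex `x`. -/
noncomputable def matchingEdge {M : G.Subgraph} (hM : M.IsPerfectMatching) (x : V) : M.edgeSet :=
  hM.1.toEdge ⟨x, hM.2 x⟩

open Classical in
/-- The local digraph `ldg(G,M)`, for a perfect matching `M` of `G` and a choice `σ` of signs. Its
vertices are the edges of `M`. Each edge `e = xy` of `G` outside `M` gives an edge between the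
edges of `M` that contain `x` and `y`; its sign at an edge `f` of `M` meeting `e` is the sign of
the common vertex of `e` and `f`. -/
noncomputable def ldg {M : G.Subgraph} (hM : M.IsPerfectMatching) (σ : V → Bool) :
    LocalDigraph M.edgeSet {e : Sym2 V // e ∈ G.edgeSet ∧ e ∉ M.edgeSet} where
  ends e := e.1.map (matchingEdge hM)
  not_isDiag := by
    rintro ⟨e, heG, heM⟩
    induction e with
    | _ x y =>
      intro h
      simp only [Sym2.map_mk, Sym2.mk_isDiag_iff] at h
      have hx : x ∈ (matchingEdge hM x : Sym2 V) := hM.1.mem_coe_toEdge (hM.2 x)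
      have hy : y ∈ (matchingEdge hM x : Sym2 V) := h ▸ hM.1.mem_coe_toEdge (hM.2 y)
      have hne : x ≠ y := G.ne_of_adj heG
      have hxy : (matchingEdge hM x : Sym2 V) = s(x, y) := (Sym2.mem_and_mem_iff hne).1 ⟨hx, hy⟩
      exact heM (hxy ▸ (matchingEdge hM x).2)
  sgn f e := decide (∃ x, x ∈ e.1 ∧ x ∈ (f : Sym2 V) ∧ σ x = true)

end Ldg

end EdgeInducibility

open Topology

namespace EdgeInducibility

/-! Write k = |M|. The all-1/2 weighting and the perfect matching give α*(G) = k, so the middle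
quantity is limsup k!·eind(G,m)/m^k (`const_mul_eind_eq`). Both inequalities compare graphs with
about m edges to local digraphs, through the fact that G is recovered from ldg(G,M) as its signed
graph (`isoSignedGraphLdg`).

Upper bound: the m edges of a graph H are made the vertices of a local digraph. An induced copy of G
in H sends M to k edges of H that induce a copy of ldg(G,M), and the copy of G is the union of these
edges. Hence eind(G,m) is at most the maximal number of induced copies of ldg(G,M) on m vertices,
and k!·C(m,k) ≤ m^k.

Lower bound: let D be acyclic on n vertices. Acyclicity gives exponents r on signed vertices with
r(v,+) + r(v,-) = K+1 for every v, and total at most K across every edge of D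
(`IsAcyclic.exists_exponents`). Blow up each signed vertex x to q^r(x) vertices. The pairs
(v,+),(v,-) carry n·q^(K+1) edges and all other edges together are O(q^K), so m ~ n·q^(K+1) as q
grows. Each induced copy of ldg(G,M) in D yields q^((K+1)k) induced copies of G, so the limsup is at
least k!·N_ind/n^k for every such D; finally n → ∞. -/

theorem graphIndCount_le_of_iso {V W W' : Type*} [Finite W'] (G : SimpleGraph V)
    {H : SimpleGraph W} {H' : SimpleGraph W'} (φ : H ≃g H') :
    graphIndCount G H ≤ graphIndCount G H' := by
  refine Set.ncard_le_ncard_of_injOn (fun S => φ '' S) ?_ ?_ (Set.toFinite _)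
  · rintro S ⟨ψ⟩
    have e : H.induce S ≃g H'.induce (φ '' S) :=
      ⟨φ.toEquiv.image S, fun {a b} => by simpa [Equiv.image] using φ.map_adj_iff⟩
    exact ⟨ψ.trans e⟩
  · exact (Set.image_injective.2 φ.injective).injOn

theorem graphIndCount_le_eindNum {V W : Type*} [Finite W] (G : SimpleGraph V)
    (H : SimpleGraph W) : (graphIndCount G H : ℝ≥0∞) ≤ eindNum G H.edgeSet.ncard := by
  obtain ⟨n, ⟨e⟩⟩ := Finite.exists_equiv_fin W
  let H' : SimpleGraph (Fin n) := H.comap e.symm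
  let φ : H ≃g H' := ⟨e, by simp [H']⟩
  have hcard : H'.edgeSet.ncard = H.edgeSet.ncard := by
    rw [← Nat.card_coe_set_eq, ← Nat.card_coe_set_eq]
    exact (Nat.card_congr φ.mapEdgeSet).symm
  refine le_trans ?_ (le_iSup₂_of_le n H' (le_iSup_of_le hcard le_rfl))
  exact_mod_cast graphIndCount_le_of_iso G φ

/-! ### Signed graphs and isomorphisms of local digraphs -/

namespace LocalDigraph

variable {V E W F : Type*}

/-- The graph on the signed vertices of a local digraph: the two signed copies of a vertex are
adjacent, and every edge of the local digraph joins the signed vertices it sees at its ends. -/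
def signedGraph (D : LocalDigraph V E) : SimpleGraph (V × Bool) where
  Adj x y := (x.1 = y.1 ∧ x.2 ≠ y.2) ∨
    ∃ e, D.ends e = s(x.1, y.1) ∧ D.sgn x.1 e = x.2 ∧ D.sgn y.1 e = y.2
  symm := ⟨by
    rintro x y (h | ⟨e, h1, h2, h3⟩)
    · exact Or.inl ⟨h.1.symm, h.2.symm⟩
    · exact Or.inr ⟨e, by rw [h1, Sym2.eq_swap], h3, h2⟩⟩
  loopless := ⟨by
    rintro x (h | ⟨e, h1, -⟩)
    · exact h.2 rfl
    · exact D.not_isDiag e (by simp [h1])⟩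

theorem signedGraph_adj (D : LocalDigraph V E) (x y : V × Bool) :
    D.signedGraph.Adj x y ↔ (x.1 = y.1 ∧ x.2 ≠ y.2) ∨
      ∃ e, D.ends e = s(x.1, y.1) ∧ D.sgn x.1 e = x.2 ∧ D.sgn y.1 e = y.2 :=
  Iff.rfl

/-- With only two signs, preserving agreement of signs at a vertex leaves exactly the freedom of one
flip there; it is read off from a reference edge. -/
theorem Iso.exists_switch {D : LocalDigraph V E} {H : LocalDigraph W F} (φ : Iso D H) :
    ∃ τ : V → Bool, ∀ v e, v ∈ D.ends e →
      H.sgn (φ.onV v) (φ.onE e) = xor (τ v) (D.sgn v e) := by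
  classical
  -- At an isolated vertex the flip is irrelevant and defaults to `false`.
  refine ⟨fun v => if h : ∃ e, v ∈ D.ends e then
    xor (H.sgn (φ.onV v) (φ.onE h.choose)) (D.sgn v h.choose) else false, fun v e he => ?_⟩
  have h : ∃ e, v ∈ D.ends e := ⟨e, he⟩
  have := φ.sgn_iff v e h.choose he h.choose_spec
  beta_reduce
  rw [dif_pos h]
  generalize D.sgn v e = a at *
  generalize D.sgn v h.choose = b at *
  generalize H.sgn (φ.onV v) (φ.onE e) = c at *
  generalize H.sgn (φ.onV v) (φ.onE h.choose) = d at *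
  revert a b c d
  decide

/-- Switching the signs at v only exchanges the two adjacent copies of v in the signed graph. -/
theorem Iso.nonempty_signedGraph_iso {D : LocalDigraph V E} {H : LocalDigraph W F}
    (φ : Iso D H) : Nonempty (D.signedGraph ≃g H.signedGraph) := by
  obtain ⟨τ, hτ⟩ := φ.exists_switch
  refine ⟨⟨⟨fun x => (φ.onV x.1, xor (τ x.1) x.2),
    fun y => (φ.onV.symm y.1, xor (τ (φ.onV.symm y.1)) y.2), fun x => by simp,
    fun y => by simp⟩, ?_⟩⟩
  rintro ⟨v, s⟩ ⟨w, t⟩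
  simp only [signedGraph_adj, Equiv.coe_fn_mk, EmbeddingLike.apply_eq_iff_eq]
  refine or_congr ?_ ?_
  · constructor <;> rintro ⟨rfl, h⟩ <;> simpa using h
  · refine ⟨?_, ?_⟩
    · rintro ⟨f, h1, h2, h3⟩
      obtain ⟨e, rfl⟩ := φ.onE.surjective f
      have he : D.ends e = s(v, w) := by
        rw [φ.ends_onE] at h1
        exact Sym2.map.injective φ.onV.injective (by simpa using h1)
      rw [hτ v e (by simp [he])] at h2
      rw [hτ w e (by simp [he])] at h3
      exact ⟨e, he, by simpa using h2, by simpa using h3⟩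
    · rintro ⟨e, he, h2, h3⟩
      exact ⟨φ.onE e, by simp [φ.ends_onE, he], by rw [hτ v e (by simp [he]), h2],
        by rw [hτ w e (by simp [he]), h3]⟩

theorem map_val_ends_induce (H : LocalDigraph V E) (S : Set V)
    (e : {e : E // ∀ v ∈ H.ends e, v ∈ S}) :
    ((H.induce S).ends e).map Subtype.val = H.ends e.1 :=
  Sym2.attachWith_map_subtypeVal e.2

theorem ends_induce_eq_iff (H : LocalDigraph V E) (S : Set V)
    (e : {e : E // ∀ v ∈ H.ends e, v ∈ S}) (p : Sym2 S) :
    (H.induce S).ends e = p ↔ H.ends e.1 = p.map Subtype.val := by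
  rw [← map_val_ends_induce, (Sym2.map.injective Subtype.val_injective).eq_iff]

theorem mem_ends_induce_iff (H : LocalDigraph V E) (S : Set V)
    (e : {e : E // ∀ v ∈ H.ends e, v ∈ S}) (v : S) :
    v ∈ (H.induce S).ends e ↔ v.1 ∈ H.ends e.1 := by
  rw [← map_val_ends_induce]
  simp

theorem signedGraph_induce_adj (D : LocalDigraph V E) (S : Set V) (x y : S × Bool) :
    (D.induce S).signedGraph.Adj x y ↔ D.signedGraph.Adj (x.1.1, x.2) (y.1.1, y.2) := by
  simp only [signedGraph_adj, Subtype.ext_iff, ends_induce_eq_iff]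
  refine or_congr Iff.rfl ⟨?_, ?_⟩
  · rintro ⟨e, h1, h2, h3⟩
    exact ⟨e.1, by simpa using h1, h2, h3⟩
  · rintro ⟨e, h1, h2, h3⟩
    have he : ∀ v ∈ D.ends e, v ∈ S := by
      intro v hv
      rw [h1, Sym2.mem_iff] at hv
      rcases hv with rfl | rfl
      exacts [x.1.2, y.1.2]
    exact ⟨⟨e, he⟩, by simpa using h1, h2, h3⟩

/-- The composition of two isomorphisms of local digraphs. -/
def Iso.trans {X K : Type*} {D : LocalDigraph V E} {H : LocalDigraph W F} {L : LocalDigraph X K}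
    (φ : Iso D H) (ψ : Iso H L) : Iso D L where
  onV := φ.onV.trans ψ.onV
  onE := φ.onE.trans ψ.onE
  ends_onE e := by simp [ψ.ends_onE, φ.ends_onE, Sym2.map_map]
  sgn_iff v e e' h h' := by
    rw [φ.sgn_iff v e e' h h']
    exact ψ.sgn_iff _ _ _ (by rw [φ.ends_onE]; exact Sym2.mem_map.2 ⟨v, h, rfl⟩)
      (by rw [φ.ends_onE]; exact Sym2.mem_map.2 ⟨v, h', rfl⟩)

/-- The restriction of an isomorphism of local digraphs to a vertex set and its image. -/
def Iso.induce {D : LocalDigraph V E} {H : LocalDigraph W F} (φ : Iso D H) (S : Set V) :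
    Iso (D.induce S) (H.induce (φ.onV '' S)) where
  onV := φ.onV.image S
  onE := φ.onE.subtypeEquiv fun e => by
    rw [φ.ends_onE]
    simp [Sym2.mem_map]
  ends_onE e := by
    rw [ends_induce_eq_iff, Sym2.map_map]
    change H.ends (φ.onE e.1) = _
    rw [φ.ends_onE, ← map_val_ends_induce, Sym2.map_map]
    rfl
  sgn_iff v e e' h h' := φ.sgn_iff v.1 e.1 e'.1 ((mem_ends_induce_iff D S e v).1 h)
    ((mem_ends_induce_iff D S e' v).1 h')

theorem indCount_le_of_iso {X K : Type*} [Finite X] (G : LocalDigraph V E)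
    {H : LocalDigraph W F} {H' : LocalDigraph X K} (φ : Iso H H') :
    indCount G H ≤ indCount G H' := by
  refine Set.ncard_le_ncard_of_injOn (fun S => φ.onV '' S) ?_ ?_ (Set.toFinite _)
  · rintro S ⟨ψ⟩
    exact ⟨ψ.trans (φ.induce S)⟩
  · exact (Set.image_injective.2 φ.onV.injective).injOn

/-- A local digraph with renamed vertices and edges. -/
def relabel (D : LocalDigraph V E) (f : V ≃ W) (g : E ≃ F) : LocalDigraph W F where
  ends e := (D.ends (g.symm e)).map f
  not_isDiag e h := D.not_isDiag (g.symm e) (by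
    have := h.map (f := f.symm)
    simpa [Sym2.map_map] using this)
  sgn w e := D.sgn (f.symm w) (g.symm e)

/-- A local digraph is isomorphic to each of its relabellings. -/
def relabelIso (D : LocalDigraph V E) (f : V ≃ W) (g : E ≃ F) : Iso D (D.relabel f g) where
  onV := f
  onE := g
  ends_onE e := by simp [relabel]
  sgn_iff v e e' _ _ := by simp [relabel]

theorem exists_fin_indCount_le [Finite V] [Finite E] (G : LocalDigraph W F)
    (H : LocalDigraph V E) {n : ℕ} (hn : Nat.card V = n) :
    ∃ (m : ℕ) (H' : LocalDigraph (Fin n) (Fin m)), indCount G H ≤ indCount G H' :=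
  ⟨_, _, indCount_le_of_iso G (H.relabelIso (Finite.equivFinOfCardEq hn) (Finite.equivFin E))⟩

end LocalDigraph

/-! ### Recovering a graph from its matching and its local digraph -/

section Matching

variable {V : Type*} {G : SimpleGraph V} {M : G.Subgraph}

theorem mem_matchingEdge (hM : M.IsPerfectMatching) (x : V) :
    x ∈ (matchingEdge hM x : Sym2 V) :=
  hM.1.mem_coe_toEdge (hM.2 x)

theorem matchingEdge_eq_iff_mem (hM : M.IsPerfectMatching) (x : V) (f : M.edgeSet) :
    matchingEdge hM x = f ↔ x ∈ (f : Sym2 V) := by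
  refine ⟨fun h => h ▸ mem_matchingEdge hM x, fun hx => ?_⟩
  obtain ⟨f, hf⟩ := f
  obtain ⟨y, rfl⟩ := Sym2.mem_iff_exists.1 hx
  exact hM.1.toEdge_eq_of_adj (M.mem_edgeSet.1 hf)

theorem matchingEdge_eq_matchingEdge_iff (hM : M.IsPerfectMatching) (x y : V) :
    matchingEdge hM x = matchingEdge hM y ↔ x = y ∨ M.Adj x y := by
  refine ⟨fun h => ?_, ?_⟩
  · by_cases hxy : x = y
    · exact Or.inl hxy
    · have h1 := mem_matchingEdge hM x
      have h2 : y ∈ (matchingEdge hM x : Sym2 V) := h ▸ mem_matchingEdge hM y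
      have h3 := (Sym2.mem_and_mem_iff hxy).1 ⟨h1, h2⟩
      have h4 := (matchingEdge hM x).2
      rw [h3] at h4
      exact Or.inr (M.mem_edgeSet.1 h4)
  · rintro (rfl | h)
    · rfl
    · exact hM.1.toEdge_eq_toEdge_of_adj h

theorem eq_of_matchingEdge_eq_of_sign_eq (hM : M.IsPerfectMatching) {σ : V → Bool}
    (hσ : IsSignLabelling M σ) {x y : V} (h : matchingEdge hM x = matchingEdge hM y)
    (h' : σ x = σ y) : x = y :=
  ((matchingEdge_eq_matchingEdge_iff hM x y).1 h).resolve_right fun h => hσ x y h h'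

/-- An edge outside M shares at most one vertex with a matching edge; this makes the sign in `ldg`
unambiguous. -/
theorem eq_of_mem_of_mem_matchingEdge (hM : M.IsPerfectMatching) {e : Sym2 V}
    (he : e ∉ M.edgeSet) {x z : V} (hx : x ∈ e) (hz : z ∈ e)
    (hz' : z ∈ (matchingEdge hM x : Sym2 V)) : z = x := by
  by_contra hne
  have h1 := (Sym2.mem_and_mem_iff hne).1 ⟨hz, hx⟩
  have h2 := (Sym2.mem_and_mem_iff hne).1 ⟨hz', mem_matchingEdge hM x⟩
  exact he (h1 ▸ h2 ▸ (matchingEdge hM x).2)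

theorem ldg_sgn (hM : M.IsPerfectMatching) (σ : V → Bool)
    (e : {e : Sym2 V // e ∈ G.edgeSet ∧ e ∉ M.edgeSet}) {x : V} (hx : x ∈ e.1) :
    (ldg hM σ).sgn (matchingEdge hM x) e = σ x := by
  rw [Bool.eq_iff_iff]
  simp only [ldg, decide_eq_true_eq]
  constructor
  · rintro ⟨z, h1, h2, h3⟩
    rwa [← eq_of_mem_of_mem_matchingEdge hM e.2.2 hx h1 h2]
  · exact fun h => ⟨x, hx, mem_matchingEdge hM x, h⟩

theorem mem_ldg_ends_iff (hM : M.IsPerfectMatching) (σ : V → Bool)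
    (e : {e : Sym2 V // e ∈ G.edgeSet ∧ e ∉ M.edgeSet}) (f : M.edgeSet) :
    f ∈ (ldg hM σ).ends e ↔ ∃ x ∈ e.1, matchingEdge hM x = f :=
  Sym2.mem_map

/-- A vertex of a graph with a perfect matching is determined by its matching edge and
its sign. -/
noncomputable def signedMatchingEquiv (hM : M.IsPerfectMatching) {σ : V → Bool}
    (hσ : IsSignLabelling M σ) : V ≃ M.edgeSet × Bool :=
  Equiv.ofBijective (fun x => (matchingEdge hM x, σ x)) <| by
    refine ⟨fun x y h => ?_, ?_⟩
    · rw [Prod.mk.injEq] at h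
      exact eq_of_matchingEdge_eq_of_sign_eq hM hσ h.1 h.2
    · rintro ⟨⟨f, hf⟩, s⟩
      induction f with
      | _ x y =>
        have hxy : M.Adj x y := hf
        by_cases hs : σ x = s
        · exact ⟨x, Prod.ext ((matchingEdge_eq_iff_mem hM _ _).2 (by simp)) hs⟩
        · refine ⟨y, Prod.ext ((matchingEdge_eq_iff_mem hM _ _).2 (by simp)) ?_⟩
          have := hσ x y hxy
          change σ y = s
          revert hs this
          generalize σ x = a
          generalize σ y = b
          revert a b s
          decide

theorem signedMatchingEquiv_apply (hM : M.IsPerfectMatching) {σ : V → Bool}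
    (hσ : IsSignLabelling M σ) (x : V) :
    signedMatchingEquiv hM hσ x = (matchingEdge hM x, σ x) :=
  rfl

/-- A graph with a perfect matching is recovered from its local digraph. -/
noncomputable def isoSignedGraphLdg (hM : M.IsPerfectMatching) {σ : V → Bool}
    (hσ : IsSignLabelling M σ) : G ≃g (ldg hM σ).signedGraph where
  toEquiv := signedMatchingEquiv hM hσ
  map_rel_iff' := by
    intro x y
    simp only [signedMatchingEquiv_apply, LocalDigraph.signedGraph_adj]
    constructor
    · rintro (⟨h1, h2⟩ | ⟨e, h1, h2, h3⟩)
      · rcases (matchingEdge_eq_matchingEdge_iff hM x y).1 h1 with rfl | h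
        · exact absurd rfl h2
        · exact h.adj_sub
      · have hne : matchingEdge hM x ≠ matchingEdge hM y := by
          intro h
          exact (ldg hM σ).not_isDiag e (by simp [h1, h])
        obtain ⟨x', hx', hxx⟩ := (mem_ldg_ends_iff hM σ e (matchingEdge hM x)).1 (by simp [h1])
        obtain ⟨y', hy', hyy⟩ := (mem_ldg_ends_iff hM σ e (matchingEdge hM y)).1 (by simp [h1])
        rw [← hxx, ldg_sgn hM σ e hx'] at h2
        rw [← hyy, ldg_sgn hM σ e hy'] at h3
        obtain rfl := eq_of_matchingEdge_eq_of_sign_eq hM hσ hxx h2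
        obtain rfl := eq_of_matchingEdge_eq_of_sign_eq hM hσ hyy h3
        have hne' : x' ≠ y' := fun h => hne (h ▸ rfl)
        have h4 := e.2.1
        rwa [(Sym2.mem_and_mem_iff hne').1 ⟨hx', hy'⟩] at h4
    · intro h
      by_cases hm : M.Adj x y
      · exact Or.inl ⟨(matchingEdge_eq_matchingEdge_iff hM x y).2 (Or.inr hm), hσ x y hm⟩
      · refine Or.inr ⟨⟨s(x, y), h, hm⟩, rfl, ldg_sgn hM σ _ (by simp), ldg_sgn hM σ _ (by simp)⟩

theorem fracIndepNum_eq [Fintype V] (hM : M.IsPerfectMatching) {σ : V → Bool}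
    (hσ : IsSignLabelling M σ) : fracIndepNum G = M.edgeSet.ncard := by
  classical
  have : Fintype M.edgeSet := Fintype.ofFinite _
  have hsum : ∀ a : V → ℝ, ∑ v, a v = ∑ f : M.edgeSet,
      (a ((signedMatchingEquiv hM hσ).symm (f, true)) +
        a ((signedMatchingEquiv hM hσ).symm (f, false))) := by
    intro a
    rw [← Equiv.sum_comp (signedMatchingEquiv hM hσ).symm, Fintype.sum_prod_type]
    simp
  have hcard : (Fintype.card M.edgeSet : ℝ) = M.edgeSet.ncard := by
    rw [← Nat.card_coe_set_eq, Nat.card_eq_fintype_card]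
  have hadj : ∀ f : M.edgeSet, G.Adj ((signedMatchingEquiv hM hσ).symm (f, true))
      ((signedMatchingEquiv hM hσ).symm (f, false)) := by
    intro f
    refine ((isoSignedGraphLdg hM hσ).symm.map_adj_iff).2 ?_
    simp [LocalDigraph.signedGraph_adj]
  -- The constant 1/2 attains |M|; summing the edge constraints over M shows that nothing exceeds
  -- it.
  refine IsGreatest.csSup_eq ⟨⟨fun _ => 1 / 2, fun _ => by norm_num, fun _ _ _ => by norm_num, ?_⟩,
    ?_⟩
  · rw [hsum, ← hcard]
    norm_num
  · rintro s ⟨a, -, h, rfl⟩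
    rw [hsum, ← hcard]
    calc _ ≤ ∑ f : M.edgeSet, (1 : ℝ) := Finset.sum_le_sum fun f _ => h _ _ (hadj f)
      _ = _ := by simp

end Matching

/-! ### Upper bound: the local digraph on the edges of a graph -/

/-- The edges of the local digraph on the edges of a graph `H`: pairs of an edge of `H` and
a pair of distinct edges of `H` that contain its endpoints. -/
abbrev EdgeLink {W : Type*} (H : SimpleGraph W) : Type _ :=
  {p : Sym2 W × Sym2 H.edgeSet // p.1 ∈ H.edgeSet ∧ ∃ (x y : W) (e f : H.edgeSet),
    p.1 = s(x, y) ∧ p.2 = s(e, f) ∧ x ∈ (e : Sym2 W) ∧ y ∈ (f : Sym2 W) ∧ e ≠ f}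

open Classical in
/-- The local digraph on all edges of a graph `H`, in which every edge of `H` that meets two other
edges gives an edge between them. A chosen endpoint of every edge carries the positive sign. -/
noncomputable def edgeLocalDigraph {W : Type*} (H : SimpleGraph W) :
    LocalDigraph H.edgeSet (EdgeLink H) where
  ends p := p.1.2
  not_isDiag := by
    rintro ⟨⟨g, p⟩, -, x, y, e, f, -, h, -, -, hne⟩
    change p = s(e, f) at h
    change ¬ p.IsDiag
    rwa [h, Sym2.mk_isDiag_iff]
  sgn e p := decide (∃ x ∈ p.1.1, x ∈ (e : Sym2 W) ∧ x = (Quot.out (e : Sym2 W)).1)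

section

variable {V W : Type*} {G : SimpleGraph V} {M : G.Subgraph} {H : SimpleGraph W}

/-- The image of an edge of a subgraph under an embedding of graphs. -/
def embedEdge (M : G.Subgraph) (ψ : G ↪g H) (f : M.edgeSet) : H.edgeSet :=
  ψ.mapEdgeSet ⟨f.1, M.edgeSet_subset f.2⟩

theorem coe_embedEdge (ψ : G ↪g H) (f : M.edgeSet) :
    (embedEdge M ψ f : Sym2 W) = f.1.map ψ :=
  rfl

theorem embedEdge_injective (ψ : G ↪g H) : Function.Injective (embedEdge M ψ) := by
  intro f f' h
  have h1 := congrArg Subtype.val h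
  rw [coe_embedEdge, coe_embedEdge] at h1
  exact Subtype.ext (Sym2.map.injective ψ.injective h1)

theorem mem_embedEdge_iff (ψ : G ↪g H) (f : M.edgeSet) (x : V) :
    ψ x ∈ (embedEdge M ψ f : Sym2 W) ↔ x ∈ f.1 := by
  rw [coe_embedEdge, Sym2.mem_map]
  simp

/-- The image of an edge outside the matching under an embedding of graphs. -/
noncomputable def embedLink (hM : M.IsPerfectMatching) (ψ : G ↪g H)
    (e : {e : Sym2 V // e ∈ G.edgeSet ∧ e ∉ M.edgeSet}) : EdgeLink H :=
  ⟨(e.1.map ψ, (e.1.map (matchingEdge hM)).map (embedEdge M ψ)), by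
    obtain ⟨e, heG, heM⟩ := e
    induction e with
    | _ x y =>
      refine ⟨ψ.map_adj_iff.2 heG, ψ x, ψ y, embedEdge M ψ (matchingEdge hM x),
        embedEdge M ψ (matchingEdge hM y), rfl, rfl,
        (mem_embedEdge_iff ψ _ _).2 (mem_matchingEdge hM x),
        (mem_embedEdge_iff ψ _ _).2 (mem_matchingEdge hM y), fun h => ?_⟩
      rcases (matchingEdge_eq_matchingEdge_iff hM x y).1 (embedEdge_injective ψ h) with rfl | h
      · exact G.loopless.irrefl _ heG
      · exact heM h⟩

theorem edgeLocalDigraph_sgn_embedLink (hM : M.IsPerfectMatching) (ψ : G ↪g H)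
    (e : {e : Sym2 V // e ∈ G.edgeSet ∧ e ∉ M.edgeSet}) {x : V} (hx : x ∈ e.1) :
    (edgeLocalDigraph H).sgn (embedEdge M ψ (matchingEdge hM x)) (embedLink hM ψ e) = true ↔
      ψ x = (Quot.out (embedEdge M ψ (matchingEdge hM x) : Sym2 W)).1 := by
  simp only [edgeLocalDigraph, embedLink, decide_eq_true_eq]
  constructor
  · rintro ⟨z, h1, h2, h3⟩
    obtain ⟨z, hz, rfl⟩ := Sym2.mem_map.1 h1
    obtain rfl := eq_of_mem_of_mem_matchingEdge hM e.2.2 hx hz ((mem_embedEdge_iff ψ _ _).1 h2)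
    exact h3
  · exact fun h => ⟨ψ x, Sym2.mem_map.2 ⟨x, hx, rfl⟩,
      (mem_embedEdge_iff ψ _ _).2 (mem_matchingEdge hM x), h⟩

/-- Inducedness: since ψ reflects adjacency, a link between two embedded matching edges already
comes from an edge of G. -/
theorem exists_embedLink_eq (hM : M.IsPerfectMatching) (ψ : G ↪g H) (p : EdgeLink H)
    (hp : ∀ v ∈ (edgeLocalDigraph H).ends p, v ∈ Set.range (embedEdge M ψ)) :
    ∃ e, embedLink hM ψ e = p := by
  obtain ⟨⟨g, q⟩, hg, x', y', e', f', h1, h2, hx, hy, hne⟩ := p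
  simp only at hg h1 h2
  subst h1 h2
  obtain ⟨e, rfl⟩ := hp e' (by simp [edgeLocalDigraph])
  obtain ⟨f, rfl⟩ := hp f' (by simp [edgeLocalDigraph])
  rw [coe_embedEdge, Sym2.mem_map] at hx hy
  obtain ⟨x, hxe, rfl⟩ := hx
  obtain ⟨y, hyf, rfl⟩ := hy
  have hef : e ≠ f := fun h => hne (h ▸ rfl)
  rw [← matchingEdge_eq_iff_mem hM] at hxe hyf
  -- The edge xy lies outside M because its ends lie on different matching edges.
  refine ⟨⟨s(x, y), ψ.map_adj_iff.1 hg, fun h => hef ?_⟩, ?_⟩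
  · rw [← hxe, ← hyf]
    exact (matchingEdge_eq_matchingEdge_iff hM x y).2 (Or.inr h)
  · refine Subtype.ext ?_
    simp [embedLink, hxe, hyf]

theorem nonempty_iso_ldg_induce_range (hM : M.IsPerfectMatching) {σ : V → Bool}
    (hσ : IsSignLabelling M σ) (ψ : G ↪g H) :
    Nonempty (LocalDigraph.Iso (ldg hM σ)
      ((edgeLocalDigraph H).induce (Set.range (embedEdge M ψ)))) := by
  have hends : ∀ e, ∀ v ∈ (edgeLocalDigraph H).ends (embedLink hM ψ e),
      v ∈ Set.range (embedEdge M ψ) := by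
    intro e v hv
    obtain ⟨f, -, rfl⟩ := Sym2.mem_map.1 hv
    exact ⟨f, rfl⟩
  refine ⟨⟨Equiv.ofInjective _ (embedEdge_injective ψ),
    Equiv.ofBijective (fun e => ⟨embedLink hM ψ e, hends e⟩) ⟨?_, ?_⟩, ?_, ?_⟩⟩
  · intro e e' h
    have h1 := congrArg (fun p => p.1.1.1) h
    exact Subtype.ext (Sym2.map.injective ψ.injective h1)
  · rintro ⟨p, hp⟩
    obtain ⟨e, rfl⟩ := exists_embedLink_eq hM ψ p hp
    exact ⟨e, rfl⟩
  · intro e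
    rw [LocalDigraph.ends_induce_eq_iff, Sym2.map_map]
    rfl
  · intro f e e' he he'
    obtain ⟨x, hx, rfl⟩ := (mem_ldg_ends_iff hM σ e f).1 he
    obtain ⟨x', hx', hxx⟩ := (mem_ldg_ends_iff hM σ e' _).1 he'
    rw [ldg_sgn hM σ e hx]
    conv_lhs => rw [← hxx, ldg_sgn hM σ e' hx']
    change _ ↔ (edgeLocalDigraph H).sgn (embedEdge M ψ (matchingEdge hM x)) (embedLink hM ψ e) =
      (edgeLocalDigraph H).sgn (embedEdge M ψ (matchingEdge hM x)) (embedLink hM ψ e')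
    have h1 := edgeLocalDigraph_sgn_embedLink hM ψ e hx
    have h2 := edgeLocalDigraph_sgn_embedLink hM ψ e' hx'
    rw [hxx] at h2
    rw [Bool.eq_iff_iff (b := (edgeLocalDigraph H).sgn _ (embedLink hM ψ e')), h1, h2]
    -- On both sides, two edges have equal signs at a matching edge exactly when they attach to the
    -- same endpoint of it. If they attach to different endpoints, exactly one of these is the
    -- chosen positive endpoint.
    rcases (matchingEdge_eq_matchingEdge_iff hM x' x).1 hxx with rfl | hadj
    · simp
    · have hs : matchingEdge hM x = ⟨s(x', x), hadj⟩ :=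
        (matchingEdge_eq_iff_mem hM _ _).2 (by simp)
      have hout := Sym2.out_fst_mem (embedEdge M ψ (matchingEdge hM x) : Sym2 W)
      generalize (Quot.out (embedEdge M ψ (matchingEdge hM x) : Sym2 W)).1 = o at hout
      rw [hs, coe_embedEdge] at hout
      have hne : x' ≠ x := hadj.ne
      have hσ' := hσ x' x hadj
      simp only [Sym2.map_mk, Sym2.mem_iff] at hout
      rcases hout with rfl | rfl <;> simp [hne, hne.symm, hσ'.symm]

theorem graphIndCount_le_indCount_edgeLocalDigraph [Finite W] (hM : M.IsPerfectMatching)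
    {σ : V → Bool} (hσ : IsSignLabelling M σ) :
    graphIndCount G H ≤ LocalDigraph.indCount (ldg hM σ) (edgeLocalDigraph H) := by
  -- Every vertex set of a copy of G is the union of the edges in some copy of `ldg`, so the counts
  -- compare through the image of this union map.
  refine le_trans (Set.ncard_le_ncard (t := (fun S : Set H.edgeSet => {w : W | ∃ e ∈ S, w ∈ e.1}) ''
    {S | Nonempty (LocalDigraph.Iso (ldg hM σ) ((edgeLocalDigraph H).induce S))}) ?_
    (Set.toFinite _)) (Set.ncard_image_le (Set.toFinite _))
  rintro T ⟨φ⟩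
  let ψ : G ↪g H := (SimpleGraph.Embedding.induce T).comp φ.toEmbedding
  refine ⟨_, nonempty_iso_ldg_induce_range hM hσ ψ, ?_⟩
  have hψ : ∀ w, w ∈ T ↔ ∃ x, ψ x = w := by
    intro w
    constructor
    · intro hw
      exact ⟨φ.symm ⟨w, hw⟩, by simp [ψ]⟩
    · rintro ⟨x, rfl⟩
      exact (φ x).2
  ext w
  simp only [Set.mem_ofPred_eq, Set.exists_range_iff, hψ]
  constructor
  · rintro ⟨f, hf⟩
    rw [coe_embedEdge, Sym2.mem_map] at hf
    exact hf.imp fun x hx => hx.2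
  · rintro ⟨x, rfl⟩
    exact ⟨matchingEdge hM x, (mem_embedEdge_iff ψ _ _).2 (mem_matchingEdge hM x)⟩

end

/-! ### Normalisation and the upper bound -/

theorem eindNum_le {V : Type*} {G : SimpleGraph V} {M : G.Subgraph} (hM : M.IsPerfectMatching)
    {σ : V → Bool} (hσ : IsSignLabelling M σ) (m : ℕ) :
    eindNum G m ≤ ⨆ (m' : ℕ) (D : LocalDigraph (Fin m) (Fin m')),
      (LocalDigraph.indCount (ldg hM σ) D : ℝ≥0∞) := by
  refine iSup_le fun n => iSup_le fun H => iSup_le fun hH => ?_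
  obtain ⟨m', D, hD⟩ := LocalDigraph.exists_fin_indCount_le (ldg hM σ) (edgeLocalDigraph H)
    ((Nat.card_coe_set_eq _).trans hH)
  refine le_iSup₂_of_le m' D ?_
  exact_mod_cast (graphIndCount_le_indCount_edgeLocalDigraph hM hσ).trans hD

theorem const_mul_eind_eq {V : Type*} [Fintype V] {G : SimpleGraph V} {M : G.Subgraph}
    (hM : M.IsPerfectMatching) {σ : V → Bool} (hσ : IsSignLabelling M σ) :
    ((2 ^ M.edgeSet.ncard * M.edgeSet.ncard.factorial : ℕ) : ℝ≥0∞)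
      / (Nat.card (G ≃g G) : ℝ≥0∞) * eind G =
    limsup (fun m : ℕ => (M.edgeSet.ncard.factorial : ℝ≥0∞) *
      (eindNum G m / (m : ℝ≥0∞) ^ M.edgeSet.ncard)) atTop := by
  have hfin : Finite (G ≃g G) := DFunLike.finite _
  have hpos : (Nat.card (G ≃g G) : ℝ≥0∞) ≠ 0 := by
    exact_mod_cast Nat.card_pos.ne'
  rw [eind, ← ENNReal.limsup_const_mul_of_ne_top
    (ENNReal.div_ne_top (ENNReal.natCast_ne_top _) hpos)]
  congr 1
  funext m
  rw [fracIndepNum_eq hM hσ, ENNReal.rpow_natCast, mul_pow]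
  generalize M.edgeSet.ncard = k
  generalize eindNum G m = A
  have h2 : (2 : ℝ≥0∞) ^ k ≠ 0 := by simp
  have h2' : (2 : ℝ≥0∞) ^ k ≠ ⊤ := by simp
  have hN : (Nat.card (G ≃g G) : ℝ≥0∞) ≠ ⊤ := ENNReal.natCast_ne_top _
  generalize (Nat.card (G ≃g G) : ℝ≥0∞) = a at *
  push_cast
  simp only [div_eq_mul_inv]
  rw [ENNReal.mul_inv (Or.inl h2) (Or.inl h2')]
  calc _ = (2 ^ k * (2 ^ k)⁻¹) * (a * a⁻¹) * ((k.factorial : ℝ≥0∞) * (A * ((m : ℝ≥0∞) ^ k)⁻¹)) := by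
        ring
    _ = _ := by rw [ENNReal.mul_inv_cancel h2 h2', ENNReal.mul_inv_cancel hpos hN, one_mul, one_mul]

theorem factorial_mul_eindNum_div_le {V : Type*} [Fintype V] {G : SimpleGraph V} {M : G.Subgraph}
    (hM : M.IsPerfectMatching) {σ : V → Bool} (hσ : IsSignLabelling M σ) {m : ℕ}
    (hm : M.edgeSet.ncard ≤ m) :
    (M.edgeSet.ncard.factorial : ℝ≥0∞) * (eindNum G m / (m : ℝ≥0∞) ^ M.edgeSet.ncard) ≤
      ⨆ (m' : ℕ) (D : LocalDigraph (Fin m) (Fin m')),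
        (LocalDigraph.indCount (ldg hM σ) D : ℝ≥0∞) / (m.choose (Nat.card M.edgeSet) : ℝ≥0∞) := by
  simp only [← ENNReal.iSup_div, Nat.card_coe_set_eq]
  have h := eindNum_le hM hσ m
  generalize (⨆ (m' : ℕ) (D : LocalDigraph (Fin m) (Fin m')),
      (LocalDigraph.indCount (ldg hM σ) D : ℝ≥0∞)) = B at *
  generalize M.edgeSet.ncard = k at *
  have hc : (m.choose k : ℝ≥0∞) ≠ 0 := by exact_mod_cast (Nat.choose_pos hm).ne'
  rw [ENNReal.le_div_iff_mul_le (Or.inl hc) (Or.inl (ENNReal.natCast_ne_top _))]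
  calc _ = ((k.factorial * m.choose k : ℕ) : ℝ≥0∞) / (m : ℝ≥0∞) ^ k * eindNum G m := by
        push_cast
        simp only [div_eq_mul_inv]
        ring
    _ ≤ 1 * B := by
        refine mul_le_mul' (ENNReal.div_le_of_le_mul ?_) h
        rw [one_mul, ← Nat.descFactorial_eq_factorial_mul_choose]
        exact_mod_cast Nat.descFactorial_le_pow m k
    _ = B := one_mul B

theorem const_mul_eind_le_ind {V : Type*} [Fintype V] {G : SimpleGraph V} {M : G.Subgraph}
    (hM : M.IsPerfectMatching) {σ : V → Bool} (hσ : IsSignLabelling M σ) :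
    ((2 ^ M.edgeSet.ncard * M.edgeSet.ncard.factorial : ℕ) : ℝ≥0∞)
      / (Nat.card (G ≃g G) : ℝ≥0∞) * eind G ≤ (ldg hM σ).ind := by
  rw [const_mul_eind_eq hM hσ, LocalDigraph.ind]
  refine limsup_le_limsup ?_
  filter_upwards [eventually_ge_atTop M.edgeSet.ncard] with m hm
  exact factorial_mul_eindNum_div_le hM hσ hm

/-! ### Lower bound: potentials of acyclic local digraphs -/

theorem exists_chain_of_transGen {α : Type*} {r : α → α → Prop} {a b : α}
    (h : Relation.TransGen r a b) :
    ∃ (t : ℕ) (f : ℕ → α), 0 < t ∧ f 0 = a ∧ f t = b ∧ ∀ i < t, r (f i) (f (i + 1)) := by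
  induction h using Relation.TransGen.head_induction_on with
  | @single a h =>
    refine ⟨1, fun i => if i = 0 then a else b, one_pos, by simp, by simp, fun i hi => ?_⟩
    obtain rfl : i = 0 := by omega
    simpa using h
  | @head a c h _ ih =>
    obtain ⟨t, f, -, h0, ht, hf⟩ := ih
    refine ⟨t + 1, fun i => Nat.casesOn i a f, by omega, rfl, ht, fun i hi => ?_⟩
    rcases i with _ | i
    · simpa [h0] using h
    · exact hf i (by omega)

namespace LocalDigraph

variable {V E W F : Type*}

theorem IsAcyclic.exists_potential [Finite V] {D : LocalDigraph V E} (h : D.IsAcyclic) :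
    ∃ p : V × Bool → ℕ, ∀ e v w, D.ends e = s(v, w) →
      p (v, D.sgn v e) < p (w, !D.sgn w e) := by
  -- The state (v, s) means being at v and about to leave by an edge of sign s, so one arrives at y
  -- by an edge of the opposite sign. A cycle of states is a locally directed closed walk.
  let r : V × Bool → V × Bool → Prop := fun x y =>
    ∃ e, D.ends e = s(x.1, y.1) ∧ D.sgn x.1 e = x.2 ∧ D.sgn y.1 e = !y.2
  have hirr : ∀ x, ¬ Relation.TransGen r x x := by
    intro x hx
    obtain ⟨t, f, ht, h0, h1, hf⟩ := exists_chain_of_transGen hx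
    have : Nonempty E := ⟨(hf 0 ht).choose⟩
    choose! e he using hf
    have hmod : ∀ i < t, e (i % t) = e i := fun i hi => by rw [Nat.mod_eq_of_lt hi]
    -- Reducing indices mod t forces `e t = e 0`, which the choice of edges does not provide.
    refine h ⟨t, fun i => (f i).1, fun i => e (i % t), ht, by simp only [h1, h0],
      by simp, ?_, ?_⟩
    · intro i hi
      beta_reduce
      rw [hmod i hi]
      exact (he i hi).1
    · intro i hi
      beta_reduce
      rw [hmod i hi, (he i hi).2.2]
      rcases Nat.lt_or_ge (i + 1) t with hlt | hge
      · rw [hmod _ hlt, (he _ hlt).2.1]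
        simp
      · obtain rfl : t = i + 1 := by omega
        rw [Nat.mod_self, h1, ← h0, (he 0 ht).2.1]
        simp
  -- The potential counts predecessors; it increases strictly along r as no state precedes itself.
  refine ⟨fun x => {y | Relation.TransGen r y x}.ncard, fun e v w hvw => ?_⟩
  have hr : r (v, D.sgn v e) (w, !D.sgn w e) := ⟨e, hvw, rfl, by simp⟩
  refine Set.ncard_lt_ncard ⟨fun y hy => Relation.TransGen.tail hy hr, fun hsub => ?_⟩
    (Set.toFinite _)
  exact hirr _ (hsub (Relation.TransGen.single hr))

theorem IsAcyclic.exists_exponents [Finite V] {D : LocalDigraph V E} (h : D.IsAcyclic) :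
    ∃ (K : ℕ) (r : V × Bool → ℕ), (∀ v, r (v, true) + r (v, false) = K + 1) ∧
      ∀ e v w, D.ends e = s(v, w) → r (v, D.sgn v e) + r (w, D.sgn w e) ≤ K := by
  obtain ⟨p, hp⟩ := h.exists_potential
  obtain ⟨L, hL⟩ := Set.finite_range p |>.bddAbove
  have hL' : ∀ x, p x ≤ L := fun x => hL ⟨x, rfl⟩
  -- The bound p ≤ L prevents truncated subtraction. Opposite signs sum to 2L + 2 = K + 1. Across an
  -- edge, reading it in both directions gives two strict inequalities, so the sum is at most 2L.
  refine ⟨2 * L + 1, fun x => p x + (L + 1) - p (x.1, !x.2), fun v => ?_, fun e v w hvw => ?_⟩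
  · have h1 := hL' (v, true)
    have h2 := hL' (v, false)
    simp only [Bool.not_true, Bool.not_false]
    omega
  · have h1 := hp e v w hvw
    have h2 := hp e w v (by rw [hvw, Sym2.eq_swap])
    have h3 := hL' (v, !D.sgn v e)
    have h4 := hL' (w, !D.sgn w e)
    dsimp only
    omega

/-! ### Lower bound: blowups -/

/-- The graph in which every signed vertex of a local digraph is blown up to an independent set
of prescribed size. -/
def blowup (D : LocalDigraph V E) (c : V × Bool → ℕ) : SimpleGraph (Σ x, Fin (c x)) :=
  D.signedGraph.comap Sigma.fst

theorem blowup_adj (D : LocalDigraph V E) (c : V × Bool → ℕ) (x y : Σ x, Fin (c x)) :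
    (D.blowup c).Adj x y ↔ D.signedGraph.Adj x.1 y.1 :=
  Iff.rfl

/-- The factor 4|V|² is the number of ordered pairs of signed vertices; parallel edges of D cost
nothing, because only such pairs matter. -/
theorem ncard_edgeSet_blowup_le [Finite V] (D : LocalDigraph V E) (c : V × Bool → ℕ) {A B : ℕ}
    (hA : ∀ v, c (v, true) * c (v, false) = A)
    (hB : ∀ e v w, D.ends e = s(v, w) → c (v, D.sgn v e) * c (w, D.sgn w e) ≤ B) :
    (D.blowup c).edgeSet.ncard ≤ Nat.card V * A + 4 * Nat.card V ^ 2 * B := by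
  classical
  have := Fintype.ofFinite V
  let P := {p : (V × Bool) × (V × Bool) // c p.1 * c p.2 ≤ B}
  let f : (Σ v : V, Fin (c (v, true)) × Fin (c (v, false))) → Sym2 (Σ x, Fin (c x)) :=
    fun z => s(⟨(z.1, true), z.2.1⟩, ⟨(z.1, false), z.2.2⟩)
  let g : (Σ p : P, Fin (c p.1.1) × Fin (c p.1.2)) → Sym2 (Σ x, Fin (c x)) :=
    fun z => s(⟨z.1.1.1, z.2.1⟩, ⟨z.1.1.2, z.2.2⟩)
  have hsub : (D.blowup c).edgeSet ⊆ Set.range f ∪ Set.range g := by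
    intro e he
    induction e with
    | _ x y =>
      obtain ⟨⟨v, s⟩, i⟩ := x
      obtain ⟨⟨w, t⟩, j⟩ := y
      rcases he with ⟨h1, h2⟩ | ⟨e, h1, h2, h3⟩
      · left
        obtain rfl : v = w := h1
        cases s <;> cases t
        · exact absurd rfl h2
        · exact ⟨⟨v, j, i⟩, Sym2.eq_swap⟩
        · exact ⟨⟨v, i, j⟩, rfl⟩
        · exact absurd rfl h2
      · right
        have h4 := hB e v w h1
        simp only at h2 h3
        rw [h2, h3] at h4
        exact ⟨⟨⟨((v, s), (w, t)), h4⟩, i, j⟩, rfl⟩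
  have hrange : ∀ {α β : Type _} [Fintype α] (f : α → β), (Set.range f).ncard ≤ Fintype.card α := by
    intro α β _ f
    rw [← Set.image_univ, ← Nat.card_eq_fintype_card, ← Set.ncard_univ]
    exact Set.ncard_image_le (Set.toFinite _)
  refine (Set.ncard_le_ncard hsub (Set.toFinite _)).trans ((Set.ncard_union_le _ _).trans
    (add_le_add ((hrange f).trans ?_) ((hrange g).trans ?_)))
  · simp [Fintype.card_sigma, hA]
  · rw [Fintype.card_sigma]
    calc _ ≤ ∑ _p : P, B := Finset.sum_le_sum fun p _ => by simpa using p.2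
      _ = Fintype.card P * B := by simp
      _ ≤ _ := by
        refine Nat.mul_le_mul_right _ ((Fintype.card_subtype_le _).trans_eq ?_)
        simp
        ring

theorem le_ncard_edgeSet_blowup [Finite V] (D : LocalDigraph V E) (c : V × Bool → ℕ) (v : V) :
    c (v, true) * c (v, false) ≤ (D.blowup c).edgeSet.ncard := by
  let f : Fin (c (v, true)) × Fin (c (v, false)) → (D.blowup c).edgeSet := fun z =>
    ⟨s(⟨(v, true), z.1⟩, ⟨(v, false), z.2⟩), by
      rw [SimpleGraph.mem_edgeSet, blowup_adj, signedGraph_adj]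
      simp⟩
  have hf : Function.Injective f := by
    rintro ⟨i, j⟩ ⟨i', j'⟩ h
    simpa [f] using h
  have := Nat.card_le_card_of_injective f hf
  rwa [Nat.card_prod, Nat.card_fin, Nat.card_fin, Nat.card_coe_set_eq] at this

/-- A choice of a vertex in each part of a blowup above the vertex set `S`. -/
def blowupSection (D : LocalDigraph V E) (c : V × Bool → ℕ) (S : Set V)
    (z : ∀ x : S × Bool, Fin (c (x.1.1, x.2))) : (D.induce S).signedGraph ↪g D.blowup c where
  toFun x := ⟨(x.1.1, x.2), z x⟩
  inj' x y h := by
    have h1 := congrArg Sigma.fst h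
    exact Prod.ext (Subtype.ext (congrArg Prod.fst h1)) (congrArg Prod.snd h1 :)
  map_rel_iff' {x y} := (signedGraph_induce_adj D S x y).symm

/-- Picking one vertex from each part above a copy S of `ldg` gives an induced copy of G, and S and
the picks can be read off from its vertex set. Each vertex of S contributes a factor A, for its two
signs. -/
theorem mul_pow_le_graphIndCount_blowup {U : Type*} {G : SimpleGraph U} [Finite V]
    {M : G.Subgraph} (hM : M.IsPerfectMatching) {σ : U → Bool} (hσ : IsSignLabelling M σ)
    (D : LocalDigraph V E) (c : V × Bool → ℕ) {A : ℕ}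
    (hA : ∀ v, c (v, true) * c (v, false) = A) :
    indCount (ldg hM σ) D * A ^ M.edgeSet.ncard ≤ graphIndCount G (D.blowup c) := by
  classical
  have := Fintype.ofFinite V
  let I := {S : Set V | Nonempty (Iso (ldg hM σ) (D.induce S))}
  let f : (Σ S : I, ∀ x : S.1 × Bool, Fin (c (x.1.1, x.2))) →
      {T : Set (Σ x, Fin (c x)) | Nonempty (G ≃g (D.blowup c).induce T)} := fun z =>
    ⟨Set.range (D.blowupSection c z.1.1 z.2), by
      obtain ⟨φ⟩ := z.1.2
      obtain ⟨ψ⟩ := φ.nonempty_signedGraph_iso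
      exact ⟨((isoSignedGraphLdg hM hσ).trans ψ).trans
        (D.blowupSection c z.1.1 z.2).isoInduceRange⟩⟩
  have hmem : ∀ z (v : V) (s : Bool) (i : Fin (c (v, s))),
      (⟨(v, s), i⟩ : Σ x, Fin (c x)) ∈ (f z).1 ↔ ∃ h : v ∈ z.1.1, z.2 (⟨v, h⟩, s) = i := by
    intro z v s i
    constructor
    · rintro ⟨⟨⟨v', h⟩, s'⟩, hx⟩
      change (⟨(v', s'), z.2 (⟨v', h⟩, s')⟩ : Σ x, Fin (c x)) = _ at hx
      cases hx
      exact ⟨h, rfl⟩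
    · rintro ⟨h, rfl⟩
      exact ⟨(⟨v, h⟩, s), rfl⟩
  have hf : Function.Injective f := by
    intro z z' h
    have hS : z.1 = z'.1 := by
      refine Subtype.ext (Set.ext fun v => ⟨fun hv => ?_, fun hv => ?_⟩)
      · have := (hmem z v true (z.2 (⟨v, hv⟩, true))).2 ⟨hv, rfl⟩
        rw [h, hmem] at this
        exact this.choose
      · have := (hmem z' v true (z'.2 (⟨v, hv⟩, true))).2 ⟨hv, rfl⟩
        rw [← h, hmem] at this
        exact this.choose
    obtain ⟨S, z⟩ := z
    obtain ⟨S', z'⟩ := z'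
    obtain rfl : S = S' := hS
    congr 1
    funext ⟨⟨v, hv⟩, s⟩
    have := (hmem ⟨S, z⟩ v s (z (⟨v, hv⟩, s))).2 ⟨hv, rfl⟩
    rw [h, hmem] at this
    exact this.choose_spec.symm
  have hcard := Nat.card_le_card_of_injective f hf
  rw [Nat.card_coe_set_eq] at hcard
  refine le_trans (le_of_eq ?_) hcard
  rw [Nat.card_eq_fintype_card, Fintype.card_sigma]
  have hfib : ∀ S : I, Fintype.card (∀ x : S.1 × Bool, Fin (c (x.1.1, x.2))) =
      A ^ M.edgeSet.ncard := by
    intro S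
    obtain ⟨φ⟩ := S.2
    rw [Fintype.card_pi, Fintype.prod_prod_type]
    simp only [Fintype.card_fin, Fintype.prod_bool, hA, Finset.prod_const, Finset.card_univ]
    rw [← Nat.card_coe_set_eq, Nat.card_congr φ.onV, Nat.card_eq_fintype_card]
  simp only [hfib, Finset.sum_const, Finset.card_univ, smul_eq_mul]
  rw [← Nat.card_eq_fintype_card, Nat.card_coe_set_eq]
  rfl

end LocalDigraph

/-! ### Lower bound: passing to the limits -/

theorem tendsto_pow_div_descFactorial (k : ℕ) :
    Tendsto (fun n : ℕ => (n : ℝ≥0∞) ^ k / (n.descFactorial k : ℝ≥0∞)) atTop (𝓝 1) := by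
  have hpos : ∀ᶠ n : ℕ in atTop, 0 < n.descFactorial k := by
    filter_upwards [eventually_ge_atTop k] with n hn
    exact Nat.pos_of_ne_zero fun h => absurd (Nat.descFactorial_eq_zero_iff_lt.1 h) (by omega)
  have h1 := (Asymptotics.isEquivalent_iff_tendsto_one
    (hpos.mono fun n hn => by exact_mod_cast hn.ne')).1 (isEquivalent_descFactorial k).symm
  have h2 := ENNReal.tendsto_ofReal h1
  rw [ENNReal.ofReal_one] at h2
  refine h2.congr' ?_
  filter_upwards [hpos] with n hn
  rw [Pi.div_apply, ENNReal.ofReal_div_of_pos (by exact_mod_cast hn),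
    ENNReal.ofReal_pow (Nat.cast_nonneg _), ENNReal.ofReal_natCast, ENNReal.ofReal_natCast]

section

variable {U V E : Type*} {G : SimpleGraph U} {M : G.Subgraph}

open LocalDigraph

theorem indCount_mul_inv_pow_le_eindNum_div [Finite V] [Nonempty V] (hM : M.IsPerfectMatching)
    {σ : U → Bool} (hσ : IsSignLabelling M σ) (D : LocalDigraph V E) {K : ℕ} {r : V × Bool → ℕ}
    (hr : ∀ v, r (v, true) + r (v, false) = K + 1)
    (hr' : ∀ e v w, D.ends e = s(v, w) → r (v, D.sgn v e) + r (w, D.sgn w e) ≤ K)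
    {q : ℕ} (hq : 0 < q) :
    (indCount (ldg hM σ) D : ℝ≥0∞) *
        ((Nat.card V + 4 * Nat.card V ^ 2 * (q : ℝ≥0∞)⁻¹)⁻¹) ^ M.edgeSet.ncard ≤
      eindNum G (D.blowup fun x => q ^ r x).edgeSet.ncard /
        ((D.blowup fun x => q ^ r x).edgeSet.ncard : ℝ≥0∞) ^ M.edgeSet.ncard := by
  have hA : ∀ v, q ^ r (v, true) * q ^ r (v, false) = q ^ (K + 1) := fun v => by
    rw [← pow_add, hr]
  have h1 := ncard_edgeSet_blowup_le D (fun x => q ^ r x) hA (B := q ^ K) fun e v w h => by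
    rw [← pow_add]
    exact Nat.pow_le_pow_right hq (hr' e v w h)
  have h2 := le_ncard_edgeSet_blowup D (fun x => q ^ r x) (Classical.arbitrary V)
  rw [hA] at h2
  have h3 : ((indCount (ldg hM σ) D * (q ^ (K + 1)) ^ M.edgeSet.ncard : ℕ) : ℝ≥0∞) ≤ _ :=
    le_trans (by exact_mod_cast mul_pow_le_graphIndCount_blowup hM hσ D (fun x => q ^ r x) hA)
      (graphIndCount_le_eindNum G (D.blowup fun x => q ^ r x))
  generalize (D.blowup fun x => q ^ r x).edgeSet.ncard = m at *
  have hm : m ≠ 0 := ((pow_pos hq (K + 1)).trans_le h2).ne'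
  have hq0 : (q : ℝ≥0∞) ≠ 0 := by exact_mod_cast hq.ne'
  -- The edge bound with q^(K+1) factored out, so that the error term carries 1/q.
  have h4 : (m : ℝ≥0∞) ≤
      (Nat.card V + 4 * Nat.card V ^ 2 * (q : ℝ≥0∞)⁻¹) * (q : ℝ≥0∞) ^ (K + 1) := by
    calc (m : ℝ≥0∞) ≤ ((Nat.card V * q ^ (K + 1) + 4 * Nat.card V ^ 2 * q ^ K : ℕ) : ℝ≥0∞) := by
          exact_mod_cast h1
      _ = Nat.card V * (q : ℝ≥0∞) ^ (K + 1) +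
          4 * Nat.card V ^ 2 * (q : ℝ≥0∞) ^ K * ((q : ℝ≥0∞)⁻¹ * q) := by
        rw [ENNReal.inv_mul_cancel hq0 (ENNReal.natCast_ne_top _), mul_one]
        push_cast
        rfl
      _ = _ := by ring
  rw [ENNReal.le_div_iff_mul_le (Or.inl (by simp [hm])) (Or.inl (by simp))]
  refine le_trans ?_ h3
  push_cast
  rw [mul_assoc, ← mul_pow]
  gcongr
  rw [mul_comm]
  exact ENNReal.div_le_of_le_mul' h4

theorem factorial_mul_indCount_div_le_limsup [Finite V] [Nonempty V] (hM : M.IsPerfectMatching)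
    {σ : U → Bool} (hσ : IsSignLabelling M σ) (D : LocalDigraph V E) (hD : D.IsAcyclic) :
    (M.edgeSet.ncard.factorial : ℝ≥0∞) *
        (indCount (ldg hM σ) D * ((Nat.card V : ℝ≥0∞)⁻¹) ^ M.edgeSet.ncard) ≤
      limsup (fun m : ℕ => (M.edgeSet.ncard.factorial : ℝ≥0∞) *
        (eindNum G m / (m : ℝ≥0∞) ^ M.edgeSet.ncard)) atTop := by
  obtain ⟨K, r, hr, hr'⟩ := hD.exists_exponents
  let μ : ℕ → ℕ := fun q => (D.blowup fun x => q ^ r x).edgeSet.ncard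
  have hμ : Tendsto μ atTop atTop := by
    refine tendsto_atTop_mono (fun q => ?_) tendsto_id
    have h := le_ncard_edgeSet_blowup D (fun x => q ^ r x) (Classical.arbitrary V)
    rw [← pow_add, hr] at h
    exact (Nat.le_self_pow (Nat.succ_ne_zero K) q).trans h
  have hlim : Tendsto (fun q : ℕ => (M.edgeSet.ncard.factorial : ℝ≥0∞) *
      (indCount (ldg hM σ) D *
        ((Nat.card V + 4 * Nat.card V ^ 2 * (q : ℝ≥0∞)⁻¹)⁻¹) ^ M.edgeSet.ncard)) atTop
      (𝓝 ((M.edgeSet.ncard.factorial : ℝ≥0∞) *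
        (indCount (ldg hM σ) D * ((Nat.card V : ℝ≥0∞)⁻¹) ^ M.edgeSet.ncard))) := by
    refine ENNReal.Tendsto.const_mul (ENNReal.Tendsto.const_mul
      (ENNReal.Tendsto.pow (tendsto_inv_iff.2 ?_)) (Or.inr (ENNReal.natCast_ne_top _)))
      (Or.inr (ENNReal.natCast_ne_top _))
    have h := ENNReal.Tendsto.const_mul (a := 4 * (Nat.card V : ℝ≥0∞) ^ 2)
      ENNReal.tendsto_inv_nat_nhds_zero
      (Or.inr (ENNReal.mul_ne_top (by simp) (ENNReal.pow_ne_top (ENNReal.natCast_ne_top _))))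
    simpa using tendsto_const_nhds.add h
  rw [← hlim.limsup_eq]
  -- The edge counts of the blowups tend to infinity, so the limsup along them is at most the full
  -- limsup over m.
  refine le_trans ?_ (limsup_le_limsup_of_le hμ)
  rw [← Filter.limsup_comp]
  refine limsup_le_limsup ?_
  filter_upwards [eventually_gt_atTop 0] with q hq
  exact mul_le_mul_right (indCount_mul_inv_pow_le_eindNum_div hM hσ D hr hr' hq) _

theorem aind_le_limsup [Finite U] (hM : M.IsPerfectMatching) {σ : U → Bool}
    (hσ : IsSignLabelling M σ) :
    (ldg hM σ).aind ≤ limsup (fun m : ℕ => (M.edgeSet.ncard.factorial : ℝ≥0∞) *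
        (eindNum G m / (m : ℝ≥0∞) ^ M.edgeSet.ncard)) atTop := by
  set C := limsup (fun m : ℕ => (M.edgeSet.ncard.factorial : ℝ≥0∞) *
        (eindNum G m / (m : ℝ≥0∞) ^ M.edgeSet.ncard)) atTop with hC
  -- The bound for fixed D has n^k where `aind` has C(n,k) = n.descFactorial k / k!; the ratio tends
  -- to 1. A limit other than 0 makes this valid even if C is infinite.
  have hlim := ENNReal.Tendsto.const_mul (a := C)
    (tendsto_pow_div_descFactorial M.edgeSet.ncard) (Or.inl one_ne_zero)
  rw [mul_one] at hlim
  rw [← hlim.limsup_eq, aind]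
  refine limsup_le_limsup ?_
  filter_upwards [eventually_gt_atTop 0, eventually_ge_atTop M.edgeSet.ncard] with n hn hk
  refine iSup_le fun m => iSup_le fun D => iSup_le fun hD => ?_
  have : Nonempty (Fin n) := ⟨⟨0, hn⟩⟩
  have h := factorial_mul_indCount_div_le_limsup hM hσ D hD
  rw [← hC, Nat.card_fin] at h
  rw [Nat.card_coe_set_eq, Nat.descFactorial_eq_factorial_mul_choose, Nat.cast_mul]
  generalize M.edgeSet.ncard = k at *
  generalize (indCount (ldg hM σ) D : ℝ≥0∞) = N at *
  have hf : (k.factorial : ℝ≥0∞) ≠ 0 := by exact_mod_cast k.factorial_ne_zero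
  have hf' : (k.factorial : ℝ≥0∞) ≠ ⊤ := ENNReal.natCast_ne_top _
  have hn0 : (n : ℝ≥0∞) ≠ 0 := by exact_mod_cast hn.ne'
  calc N / (n.choose k : ℝ≥0∞)
      = (k.factorial : ℝ≥0∞) * (N * ((n : ℝ≥0∞)⁻¹) ^ k) *
          ((n : ℝ≥0∞) ^ k / (k.factorial * n.choose k)) := by
        rw [div_eq_mul_inv, div_eq_mul_inv, ENNReal.mul_inv (Or.inl hf) (Or.inl hf')]
        calc _ = ((k.factorial : ℝ≥0∞) * (k.factorial : ℝ≥0∞)⁻¹) *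
              (((n : ℝ≥0∞)⁻¹ * n) ^ k) * (N * (n.choose k : ℝ≥0∞)⁻¹) := by
              rw [ENNReal.mul_inv_cancel hf hf',
                ENNReal.inv_mul_cancel hn0 (ENNReal.natCast_ne_top _), one_pow, one_mul, one_mul]
          _ = _ := by ring
    _ ≤ _ := mul_le_mul_left h _

end

end EdgeInducibility

theorem theorem4p7 {V : Type*} [Fintype V] (G : SimpleGraph V) (M : G.Subgraph)
    (hM : M.IsPerfectMatching)
    (hunique : ∀ w : G.edgeSet → ℝ, EdgeInducibility.IsFractionalPerfectMatching G w →
      w = EdgeInducibility.matchingWeight M)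
    (σ : V → Bool) (hσ : EdgeInducibility.IsSignLabelling M σ) :
    (EdgeInducibility.ldg hM σ).aind ≤
        ((2 ^ M.edgeSet.ncard * M.edgeSet.ncard.factorial : ℕ) : ENNReal)
          / (Nat.card (G ≃g G) : ENNReal) * EdgeInducibility.eind G ∧
      ((2 ^ M.edgeSet.ncard * M.edgeSet.ncard.factorial : ℕ) : ENNReal)
          / (Nat.card (G ≃g G) : ENNReal) * EdgeInducibility.eind G ≤
        (EdgeInducibility.ldg hM σ).ind := by
  refine ⟨?_, EdgeInducibility.const_mul_eind_le_ind hM hσ⟩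
  rw [EdgeInducibility.const_mul_eind_eq hM hσ]
  exact EdgeInducibility.aind_le_limsup hM hσ
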